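/- Let $n\ge 0$ and let $\mathfrak S_n$ be the set of permutations $\sigma=\sigma_1\cdots\sigma_n$ of $\{1,\dots,n\}$. For a letter $\ell$, which stands at position $\sigma^{-1}_\ell$, put $$\begin{aligned} 2\underline{13}(\ell,\sigma)&=\#\{j:\sigma^{-1}_\ell<j<n,\ \sigma_j<\ell<\sigma_{j+1}\},& 2\underline{31}(\ell,\sigma)&=\#\{j:\sigma^{-1}_\ell<j<n,\ \sigma_{j+1}<\ell<\sigma_j\},\\ \underline{31}2(\ell,\sigma)&=\#\{j:1<j<\sigma^{-1}_\ell,\ \sigma_j<\ell<\sigma_{j-1}\},& \underline{13}2(\ell,\sigma)&=\#\{j:1<j<\sigma^{-1}_\ell,\ \sigma_{j-1}<\ell<\sigma_j\}, \end{aligned}$$ and let $2\underline{13}(\sigma)$, $2\underline{31}(\sigma)$, $\underline{31}2(\sigma)$, $\underline{13}2(\sigma)$ be the sums of these numbers over $1\le\ell\le n$. Let $$P_n(p,q,r,s)=\sum_{\sigma\in\mathfrak S_n}p^{\underline{13}2(\sigma)}q^{\underline{31}2(\sigma)}r^{2\underline{13}(\sigma)}s^{2\underline{31}(\sigma)}.$$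 The map $\Phi_{\mathrm{SZ}}$ is defined as follows. Given $\sigma\in\mathfrak S_n$, let $F=\{\sigma_i:\sigma_i>\sigma_{i+1}\}$ and $F'=\{\sigma_{i+1}:\sigma_i>\sigma_{i+1}\}$ be its sets of descent tops and descent bottoms, and let $G,G'$ be their complements in $\{1,\dots,n\}$. For each $j\in F$, from the smallest to the largest, let $\tau_j$ be the $(\underline{31}2(j,\sigma)+1)$-th largest element of $F'$ that is smaller than $j$ and not yet chosen. For each $j\in G$, from the largest to the smallest, let $\tau_j$ be the $(\underline{31}2(j,\sigma)+1)$-th smallest element of $G'$ that is not smaller than $j$ and not yet chosen. Put $\Phi_{\mathrm{SZ}}(\sigma)=\tau=\tau_1\cdots\tau_n$. Further, put $\widehat a=n-a$ for $1\le a<n$, $\widehat n=n$, and $\widehat\theta(\sigma)=\widehat{\sigma}_n\widehat{\sigma}_{n-1}\cdots\widehat{\sigma}_1$. **Theorem.** All choices in the construction of $\Phi_{\mathrm{SZ}}$ are possible, and $\Phi_{\mathrm{SZ}}$ is a bijection of $\mathfrak S_n$ onto itself. The map $\widehat\phi=\Phi_{\mathrm{SZ}}^{-1}\circ\widehat\theta\circ\Phi_{\mathrm{SZ}}$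 is an involution on $\mathfrak S_n$ such that, for all $\sigma\in\mathfrak S_n$, $$(\underline{31}2,\,2\underline{31})\,\sigma=(\underline{31}2,\,2\underline{13})\,\widehat\phi(\sigma),$$ and consequently $$(\underline{31}2,\,2\underline{13},\,2\underline{31})\,\sigma=(\underline{31}2,\,2\underline{31},\,2\underline{13})\,\widehat\phi(\sigma).$$ Hence $P_n(1,q,r,s)=P_n(1,q,s,r)$, and also $P_n(p,1,r,s)=P_n(p,1,s,r)$, $P_n(p,q,1,s)=P_n(q,p,1,s)$ and $P_n(p,q,r,1)=P_n(q,p,r,1)$. These are the four relations conjectured by Bitonti, Deb and Sokal, and $\widehat\phi$ is a bijection that proves the equidistribution $(2\underline{13},\underline{31}2)\sim(2\underline{31},\underline{31}2)$ asked for in their open problem. -/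

import Mathlib

namespace VincularPatterns

/-! Permutations of `{1, …, n}` are modelled by `Equiv.Perm (Fin n)`: the word `σ_1 σ_2 … σ_n`
has `σ i + 1` as its letter at position `i + 1`.  Positions and letters are thus both shifted
by one, which changes no comparison between two positions or between two letters. -/

/-- The coordinate statistic `2-13` (last two letters adjacent): the number of positions `j`
to the right of the letter `ℓ` with `σ_j < ℓ < σ_{j+1}`. -/
def stat2_13At {n : ℕ} (ℓ : Fin n) (σ : Equiv.Perm (Fin n)) : ℕ :=
  (Finset.univ.filter fun j : Fin n =>
    σ.symm ℓ < j ∧ ∃ k : Fin n, (k : ℕ) = (j : ℕ) + 1 ∧ σ j < ℓ ∧ ℓ < σ k).card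

/-- The coordinate statistic `2-31` (last two letters adjacent): the number of positions `j`
to the right of the letter `ℓ` with `σ_{j+1} < ℓ < σ_j`. -/
def stat2_31At {n : ℕ} (ℓ : Fin n) (σ : Equiv.Perm (Fin n)) : ℕ :=
  (Finset.univ.filter fun j : Fin n =>
    σ.symm ℓ < j ∧ ∃ k : Fin n, (k : ℕ) = (j : ℕ) + 1 ∧ σ k < ℓ ∧ ℓ < σ j).card

/-- The coordinate statistic `31-2` (first two letters adjacent): the number of positions `j`
to the left of the letter `ℓ` with `σ_j < ℓ < σ_{j-1}`. -/
def stat31_2At {n : ℕ} (ℓ : Fin n) (σ : Equiv.Perm (Fin n)) : ℕ :=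
  (Finset.univ.filter fun j : Fin n =>
    j < σ.symm ℓ ∧ ∃ k : Fin n, (j : ℕ) = (k : ℕ) + 1 ∧ σ j < ℓ ∧ ℓ < σ k).card

/-- The coordinate statistic `13-2` (first two letters adjacent): the number of positions `j`
to the left of the letter `ℓ` with `σ_{j-1} < ℓ < σ_j`. -/
def stat13_2At {n : ℕ} (ℓ : Fin n) (σ : Equiv.Perm (Fin n)) : ℕ :=
  (Finset.univ.filter fun j : Fin n =>
    j < σ.symm ℓ ∧ ∃ k : Fin n, (j : ℕ) = (k : ℕ) + 1 ∧ σ k < ℓ ∧ ℓ < σ j).card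

/-- The number of occurrences of the vincular pattern `2-13` in `σ`. -/
def stat2_13 {n : ℕ} (σ : Equiv.Perm (Fin n)) : ℕ := ∑ ℓ, stat2_13At ℓ σ

/-- The number of occurrences of the vincular pattern `2-31` in `σ`. -/
def stat2_31 {n : ℕ} (σ : Equiv.Perm (Fin n)) : ℕ := ∑ ℓ, stat2_31At ℓ σ

/-- The number of occurrences of the vincular pattern `31-2` in `σ`. -/
def stat31_2 {n : ℕ} (σ : Equiv.Perm (Fin n)) : ℕ := ∑ ℓ, stat31_2At ℓ σ

/-- The number of occurrences of the vincular pattern `13-2` in `σ`. -/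
def stat13_2 {n : ℕ} (σ : Equiv.Perm (Fin n)) : ℕ := ∑ ℓ, stat13_2At ℓ σ

/-- The four-variable polynomial `P_n(p, q, r, s)`, evaluated at elements of an arbitrary
commutative semiring (which may be a polynomial ring, with indeterminates for `p, q, r, s`). -/
def bdsPoly {R : Type*} [CommSemiring R] (n : ℕ) (p q r s : R) : R :=
  ∑ σ : Equiv.Perm (Fin n),
    p ^ stat13_2 σ * q ^ stat31_2 σ * r ^ stat2_13 σ * s ^ stat2_31 σ

/-- The set `F` of descent tops: the letters `σ_i` with `σ_i > σ_{i+1}`. -/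
def descentTops {n : ℕ} (σ : Equiv.Perm (Fin n)) : Finset (Fin n) :=
  Finset.univ.filter fun a => ∃ i k : Fin n, (k : ℕ) = (i : ℕ) + 1 ∧ σ k < σ i ∧ a = σ i

/-- The set `F'` of descent bottoms: the letters `σ_{i+1}` with `σ_i > σ_{i+1}`. -/
def descentBottoms {n : ℕ} (σ : Equiv.Perm (Fin n)) : Finset (Fin n) :=
  Finset.univ.filter fun a => ∃ i k : Fin n, (k : ℕ) = (i : ℕ) + 1 ∧ σ k < σ i ∧ a = σ k

/-- The entries available for the column of the descent top `j`: the descent bottoms smaller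
than `j` that were not chosen for a descent top treated before, that is, smaller than `j`. -/
def availableLower {n : ℕ} (σ τ : Equiv.Perm (Fin n)) (j : Fin n) : Finset (Fin n) :=
  (descentBottoms σ).filter fun x => x < j ∧ ∀ i ∈ descentTops σ, i < j → τ i ≠ x

/-- The entries available for the column of a letter `j` that is not a descent top: the letters
that are not descent bottoms, are not smaller than `j`, and were not chosen for a non-descent-top
treated before, that is, larger than `j`. -/
def availableUpper {n : ℕ} (σ τ : Equiv.Perm (Fin n)) (j : Fin n) : Finset (Fin n) :=
  ((descentBottoms σ)ᶜ).filter fun x => j ≤ x ∧ ∀ i ∈ (descentTops σ)ᶜ, j < i → τ i ≠ x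

/-- `IsSZImage σ τ`: the Shin-Zeng construction, run on `σ`, succeeds at every step and outputs
the permutation `τ`, where `τ j` is the entry below `j` in the biword.

* For a descent top `j` (these are treated from the smallest to the largest) `τ j` is the
  `((31-2)(j, σ) + 1)`-th largest available descent bottom.
* For any other letter `j` (treated from the largest to the smallest) `τ j` is the
  `((31-2)(j, σ) + 1)`-th smallest available letter that is not a descent bottom. -/
def IsSZImage {n : ℕ} (σ τ : Equiv.Perm (Fin n)) : Prop :=
  (∀ j ∈ descentTops σ, τ j ∈ availableLower σ τ j ∧
    ((availableLower σ τ j).filter fun y => τ j < y).card = stat31_2At j σ) ∧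
  (∀ j ∈ (descentTops σ)ᶜ, τ j ∈ availableUpper σ τ j ∧
    ((availableUpper σ τ j).filter fun y => y < τ j).card = stat31_2At j σ)

/-- The map `Φ_SZ` on permutations: the output of the Shin-Zeng construction. -/
noncomputable def phiSZ {n : ℕ} (σ : Equiv.Perm (Fin n)) : Equiv.Perm (Fin n) :=
  Classical.epsilon fun τ => IsSZImage σ τ

/-- The map `a ↦ n - a` for `1 ≤ a < n` and `n ↦ n` on letters; the letter `a` is represented by
the element `a - 1` of `Fin n`. -/
def hatLetter {n : ℕ} (a : Fin n) : Fin n :=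
  if (a : ℕ) + 1 < n then ⟨n - ((a : ℕ) + 1) - 1, by have := a.isLt; omega⟩ else a

theorem hatLetter_involutive {n : ℕ} : Function.Involutive (hatLetter (n := n)) := by
  intro a
  have ha := a.isLt
  apply Fin.ext
  by_cases h : (a : ℕ) + 1 < n
  · have h2 : n - ((a : ℕ) + 1) - 1 + 1 < n := by omega
    simp only [hatLetter, h, h2, if_true]
    omega
  · simp only [hatLetter, h, if_false]

/-- The map `θ̂`, which sends the word `σ_1 … σ_n` to the word `σ̂_n σ̂_{n-1} … σ̂_1`. -/
def thetaHat {n : ℕ} (σ : Equiv.Perm (Fin n)) : Equiv.Perm (Fin n) :=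
  (Fin.revPerm.trans σ).trans (hatLetter_involutive (n := n)).toPerm

/-- The map `φ̂ = Φ_SZ⁻¹ ∘ θ̂ ∘ Φ_SZ`. -/
noncomputable def phiHat {n : ℕ} : Equiv.Perm (Fin n) → Equiv.Perm (Fin n) :=
  Function.invFun phiSZ ∘ thetaHat ∘ phiSZ

end VincularPatterns

open VincularPatterns

/-!
Draw the image `τ` of `σ` under the Shin–Zeng construction as the arcs `j → τ j`. The construction
succeeds because the number of free entries at each step is one more than the number of descents of
`σ` over the letter `j` (`exists_isSZImage`). The descent tops of `σ` are the letters `j` with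
`τ j < j`, the descent bottoms are their images, and the rank used for `j` says that the
`31-2`-statistic of `j` is the number of crossings assigned to its arc
(`VincularPatterns.IsSZImage.stat31_2At_eq`). The descents over `j` are counted by the arcs that cover
`j`, so the `2-31`-statistic of each letter is read off from `τ` as well
(`stat31_2At_add_stat2_31At_eq_coverAt`). The last letter of `σ` is the one that `τ` sends to the
largest letter (`apply_last_eq_last`), and the last letter and the descent tops determine the
difference between the `2-13`- and `2-31`-statistics (`stat2_13At_add_ite`).

Injectivity holds since a word can be read off from right to left from its descent bottoms, its last
letter and these two families of statistics (`eq_of_descentBottoms_eq`).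

In the sum over all letters, the totals of `31-2`, `2-31` and `2-13` become expressions in the
crossing number of `τ`, the total length of its descending arcs, the number of these arcs, and the
preimage of the largest letter. The map `θ̂` preserves the crossings (`crossingsAt_thetaHat`) and
changes the other three quantities in a controlled way (`sum_coverAt_thetaHat`,
`card_drops_thetaHat`, `thetaHat_symm_last`), which gives the exchange of `2-31` and `2-13` by `φ̂`
(`stat_eq_of_thetaHat`). The first polynomial relation follows, and the others are obtained from it by
reversal and complement.
-/

/-! ### Greedy choice by rank -/

theorem card_filter_lt_injOn {α : Type*} [LinearOrder α] (s : Finset α) :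
    Set.InjOn (fun x => (s.filter fun y => x < y).card) s := by
  have key : ∀ x ∈ s, ∀ y ∈ s, x < y →
      (s.filter fun z => y < z).card < (s.filter fun z => x < z).card := by
    intro x _ y hy hxy
    apply Finset.card_lt_card
    refine ⟨fun z hz => ?_, fun h => ?_⟩
    · simp only [Finset.mem_filter] at hz ⊢
      exact ⟨hz.1, hxy.trans hz.2⟩
    · have := h (Finset.mem_filter.2 ⟨hy, hxy⟩)
      simp at this
  intro x hx y hy hxy
  rcases lt_trichotomy x y with h | h | h
  · exact absurd hxy (key x hx y hy h).ne'
  · exact h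
  · exact absurd hxy (key y hy x hx h).ne

/-- A finite set with more than `k` elements has a `(k + 1)`-th largest one. -/
theorem exists_mem_card_filter_lt_eq {α : Type*} [LinearOrder α] (s : Finset α) {k : ℕ}
    (hk : k < s.card) : ∃ x ∈ s, (s.filter fun y => x < y).card = k := by
  have h := Finset.surj_on_of_inj_on_of_card_le (s := s) (t := Finset.range s.card)
    (fun x _ => (s.filter fun y => x < y).card)
    (fun x hx => by
      rw [Finset.mem_range]
      apply Finset.card_lt_card
      refine ⟨Finset.filter_subset _ _, fun h => ?_⟩
      have := h hx
      simp at this)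
    (fun x y hx hy h => card_filter_lt_injOn s hx hy h) (by simp) k (by simpa using hk)
  obtain ⟨x, hx, h⟩ := h
  exact ⟨x, hx, h.symm⟩

/-- If for each `j ∈ A` the candidates in `B` outnumber the earlier elements of `A` by more than `r j`,
one can choose for each `j ∈ A`, in increasing order, the `(r j + 1)`-th largest candidate that is
still free. The set `s` consists of the candidates free for `j`; stating its membership condition
keeps decidability instances out of the conclusion. -/
theorem exists_greedy_choice {α : Type*} [LinearOrder α] (A B : Finset α) (R : α → α → Prop)
    [∀ j, DecidablePred (R j)] (r : α → ℕ)
    (h : ∀ j ∈ A, r j + (A.filter fun i => i < j).card < (B.filter (R j)).card) :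
    ∃ f : α → α, ∀ j ∈ A, ∃ s : Finset α,
      (∀ x, x ∈ s ↔ x ∈ B ∧ R j x ∧ ∀ i ∈ A, i < j → f i ≠ x) ∧
      f j ∈ s ∧ (s.filter fun y => f j < y).card = r j := by
  induction A using Finset.induction_on_max with
  | empty => exact ⟨id, by simp⟩
  | insert a s ha ih =>
    obtain ⟨f, hf⟩ := ih fun j hj => by
      refine lt_of_le_of_lt ?_ (h j (Finset.mem_insert_of_mem hj))
      gcongr
      exact Finset.subset_insert _ _
    have hcard : r a < (B.filter (fun x => R a x ∧ ∀ i ∈ s, i < a → f i ≠ x)).card := by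
      have h1 := h a (Finset.mem_insert_self _ _)
      have h2 : (insert a s).filter (fun i => i < a) = s := by
        ext i
        simp only [Finset.mem_filter, Finset.mem_insert]
        constructor
        · rintro ⟨rfl | h, h'⟩
          · exact absurd h' (lt_irrefl _)
          · exact h
        · exact fun h => ⟨Or.inr h, ha i h⟩
      rw [h2] at h1
      have h3 : B.filter (R a) ⊆
          B.filter (fun x => R a x ∧ ∀ i ∈ s, i < a → f i ≠ x) ∪ s.image f := by
        intro x hx
        simp only [Finset.mem_filter, Finset.mem_union, Finset.mem_image] at hx ⊢
        by_cases hc : ∃ i ∈ s, f i = x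
        · exact Or.inr hc
        · push Not at hc
          exact Or.inl ⟨hx.1, hx.2, fun i hi _ => hc i hi⟩
      have h4 := (Finset.card_le_card h3).trans (Finset.card_union_le _ _)
      have h5 : (s.image f).card ≤ s.card := Finset.card_image_le
      omega
    obtain ⟨x, hx, hxr⟩ := exists_mem_card_filter_lt_eq _ hcard
    have hne : ∀ i ∈ s, Function.update f a x i = f i := fun i hi =>
      Function.update_of_ne (ha i hi).ne _ _
    have hav : ∀ j, j ≤ a → ∀ y, (∀ i ∈ insert a s, i < j → Function.update f a x i ≠ y) ↔
        ∀ i ∈ s, i < j → f i ≠ y := by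
      refine fun j hj y => ⟨fun H i hi hij => ?_, fun H i hi hij => ?_⟩
      · rw [← hne i hi]
        exact H i (Finset.mem_insert_of_mem hi) hij
      · rcases Finset.mem_insert.1 hi with rfl | hi
        · exact absurd hij hj.not_gt
        · rw [hne i hi]
          exact H i hi hij
    refine ⟨Function.update f a x, fun j hj => ?_⟩
    rcases Finset.mem_insert.1 hj with rfl | hj
    · refine ⟨_, fun y => ?_, by rwa [Function.update_self], by rwa [Function.update_self]⟩
      rw [hav j le_rfl, Finset.mem_filter]
    · obtain ⟨t, ht, hjt, hr⟩ := hf j hj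
      refine ⟨t, fun y => ?_, by rwa [hne j hj], by rwa [hne j hj]⟩
      rw [hav j (ha j hj).le, ht]

theorem exists_greedy_choice_dual {α : Type*} [LinearOrder α] (A B : Finset α)
    (R : α → α → Prop) [hR : ∀ j, DecidablePred (R j)] (r : α → ℕ)
    (h : ∀ j ∈ A, r j + (A.filter fun i => j < i).card < (B.filter (R j)).card) :
    ∃ f : α → α, ∀ j ∈ A, ∃ s : Finset α,
      (∀ x, x ∈ s ↔ x ∈ B ∧ R j x ∧ ∀ i ∈ A, j < i → f i ≠ x) ∧
      f j ∈ s ∧ (s.filter fun y => y < f j).card = r j :=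
  @exists_greedy_choice αᵒᵈ _ A B R hR r h

/-! ### Descents of a word -/

section words

variable {m : ℕ} (σ : Equiv.Perm (Fin (m + 1)))

theorem card_filter_exists_next (P : Fin (m + 1) → Fin (m + 1) → Prop) [∀ j, DecidablePred (P j)]
    (Q : Fin (m + 1) → Prop) [DecidablePred Q] :
    (Finset.univ.filter fun j : Fin (m + 1) =>
      Q j ∧ ∃ k : Fin (m + 1), (k : ℕ) = (j : ℕ) + 1 ∧ P j k).card =
    ∑ k : Fin m, if Q k.castSucc ∧ P k.castSucc k.succ then 1 else 0 := by
  rw [← Finset.card_filter]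
  symm
  refine Finset.card_bij (fun k _ => k.castSucc) ?_ ?_ ?_
  · intro k hk
    simp only [Finset.mem_filter, Finset.mem_univ, true_and] at hk ⊢
    exact ⟨hk.1, k.succ, by simp, hk.2⟩
  · intro a _ b _ h
    exact Fin.castSucc_injective _ h
  · intro j hj
    simp only [Finset.mem_filter, Finset.mem_univ, true_and] at hj ⊢
    obtain ⟨hQ, k, hk, hP⟩ := hj
    have hj' : (j : ℕ) < m := by omega
    have e : k = (⟨j, hj'⟩ : Fin m).succ := Fin.ext (by simpa using hk)
    subst e
    exact ⟨⟨j, hj'⟩, ⟨hQ, hP⟩, rfl⟩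

theorem card_filter_exists_prev (P : Fin (m + 1) → Fin (m + 1) → Prop) [∀ j, DecidablePred (P j)]
    (Q : Fin (m + 1) → Prop) [DecidablePred Q] :
    (Finset.univ.filter fun j : Fin (m + 1) =>
      Q j ∧ ∃ k : Fin (m + 1), (j : ℕ) = (k : ℕ) + 1 ∧ P j k).card =
    ∑ k : Fin m, if Q k.succ ∧ P k.succ k.castSucc then 1 else 0 := by
  rw [← Finset.card_filter]
  symm
  refine Finset.card_bij (fun k _ => k.succ) ?_ ?_ ?_
  · intro k hk
    simp only [Finset.mem_filter, Finset.mem_univ, true_and] at hk ⊢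
    exact ⟨hk.1, k.castSucc, by simp, hk.2⟩
  · intro a _ b _ h
    exact Fin.succ_injective _ h
  · intro j hj
    simp only [Finset.mem_filter, Finset.mem_univ, true_and] at hj ⊢
    obtain ⟨hQ, k, hk, hP⟩ := hj
    have hj' : (k : ℕ) < m := by omega
    have e : j = (⟨k, hj'⟩ : Fin m).succ := Fin.ext (by simpa using hk)
    subst e
    exact ⟨⟨k, hj'⟩, ⟨hQ, hP⟩, rfl⟩

theorem stat2_13At_eq_sum (ℓ : Fin (m + 1)) : stat2_13At ℓ σ =
    ∑ k : Fin m, if σ.symm ℓ < k.castSucc ∧ σ k.castSucc < ℓ ∧ ℓ < σ k.succ then 1 else 0 :=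
  card_filter_exists_next (fun j k => σ j < ℓ ∧ ℓ < σ k) (fun j => σ.symm ℓ < j)

theorem stat2_31At_eq_sum (ℓ : Fin (m + 1)) : stat2_31At ℓ σ =
    ∑ k : Fin m, if σ.symm ℓ < k.castSucc ∧ σ k.succ < ℓ ∧ ℓ < σ k.castSucc then 1 else 0 :=
  card_filter_exists_next (fun j k => σ k < ℓ ∧ ℓ < σ j) (fun j => σ.symm ℓ < j)

theorem stat31_2At_eq_sum (ℓ : Fin (m + 1)) : stat31_2At ℓ σ =
    ∑ k : Fin m, if k.succ < σ.symm ℓ ∧ σ k.succ < ℓ ∧ ℓ < σ k.castSucc then 1 else 0 :=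
  card_filter_exists_prev (fun j k => σ j < ℓ ∧ ℓ < σ k) (fun j => j < σ.symm ℓ)

theorem descentTops_eq_image : descentTops σ =
    (Finset.univ.filter fun k : Fin m => σ k.succ < σ k.castSucc).image
      fun k => σ k.castSucc := by
  ext a
  simp only [descentTops, Finset.mem_filter, Finset.mem_univ, true_and, Finset.mem_image]
  constructor
  · rintro ⟨i, k, hk, h, rfl⟩
    have hi : (i : ℕ) < m := by omega
    have e : k = (⟨i, hi⟩ : Fin m).succ := Fin.ext (by simpa using hk)
    subst e
    exact ⟨⟨i, hi⟩, h, rfl⟩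
  · rintro ⟨k, h, rfl⟩
    exact ⟨k.castSucc, k.succ, by simp, h, rfl⟩

theorem descentBottoms_eq_image : descentBottoms σ =
    (Finset.univ.filter fun k : Fin m => σ k.succ < σ k.castSucc).image
      fun k => σ k.succ := by
  ext a
  simp only [descentBottoms, Finset.mem_filter, Finset.mem_univ, true_and, Finset.mem_image]
  constructor
  · rintro ⟨i, k, hk, h, rfl⟩
    have hi : (i : ℕ) < m := by omega
    have e : k = (⟨i, hi⟩ : Fin m).succ := Fin.ext (by simpa using hk)
    subst e
    exact ⟨⟨i, hi⟩, h, rfl⟩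
  · rintro ⟨k, h, rfl⟩
    exact ⟨k.castSucc, k.succ, by simp, h, rfl⟩

theorem card_filter_descentTops (P : Fin (m + 1) → Prop) [DecidablePred P] :
    ((descentTops σ).filter P).card =
      ∑ k : Fin m, if σ k.succ < σ k.castSucc ∧ P (σ k.castSucc) then 1 else 0 := by
  rw [descentTops_eq_image, Finset.filter_image, Finset.card_image_of_injective,
    Finset.filter_filter, Finset.card_filter]
  exact σ.injective.comp (Fin.castSucc_injective _)

theorem card_filter_descentBottoms (P : Fin (m + 1) → Prop) [DecidablePred P] :
    ((descentBottoms σ).filter P).card =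
      ∑ k : Fin m, if σ k.succ < σ k.castSucc ∧ P (σ k.succ) then 1 else 0 := by
  rw [descentBottoms_eq_image, Finset.filter_image, Finset.card_image_of_injective,
    Finset.filter_filter, Finset.card_filter]
  exact σ.injective.comp (Fin.succ_injective _)

theorem card_descentTops_eq_card_descentBottoms :
    (descentTops σ).card = (descentBottoms σ).card := by
  have h1 := card_filter_descentTops σ fun _ => True
  have h2 := card_filter_descentBottoms σ fun _ => True
  rw [Finset.filter_true] at h1 h2
  rw [h1, h2]

/-- The descents that pass over the letter `ℓ` lie to its left or to its right; all of them together are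
counted by the descent tops above `ℓ`, less those whose bottom is not below `ℓ`. -/
theorem stat31_2At_add_stat2_31At (ℓ : Fin (m + 1)) :
    stat31_2At ℓ σ + stat2_31At ℓ σ + ((descentBottoms σ).filter fun x => ℓ ≤ x).card =
      ((descentTops σ).filter fun x => ℓ < x).card := by
  rw [stat31_2At_eq_sum, stat2_31At_eq_sum, card_filter_descentTops, card_filter_descentBottoms,
    ← Finset.sum_add_distrib, ← Finset.sum_add_distrib]
  refine Finset.sum_congr rfl fun k _ => ?_
  have h1 : σ k.succ = ℓ ↔ k.succ = σ.symm ℓ := (Equiv.eq_symm_apply σ).symm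
  have h2 : σ k.castSucc = ℓ ↔ k.castSucc = σ.symm ℓ := (Equiv.eq_symm_apply σ).symm
  have h3 : (k.succ : ℕ) = (k.castSucc : ℕ) + 1 := by simp
  simp only [Fin.lt_def, Fin.le_def, Fin.ext_iff] at *
  generalize (k.succ : ℕ) = a at *
  generalize (k.castSucc : ℕ) = b at *
  generalize (σ k.succ : ℕ) = c at *
  generalize (σ k.castSucc : ℕ) = d at *
  generalize (σ.symm ℓ : ℕ) = e at *
  split_ifs <;> omega

/-- To the right of `ℓ` the word alternates between letters below and above `ℓ`, so that its upward and
downward passages over `ℓ` differ only through its first step and its last letter. -/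
theorem stat2_13At_add_ite (ℓ : Fin (m + 1)) :
    stat2_13At ℓ σ + (if ℓ ∈ descentTops σ then 0 else 1) =
      stat2_31At ℓ σ + if ℓ ≤ σ (Fin.last m) then 1 else 0 := by
  -- the indicator that position `i` is to the right of `ℓ` and carries a letter above `ℓ`
  let f : Fin (m + 1) → ℕ := fun i => if σ.symm ℓ < i ∧ ℓ < σ i then 1 else 0
  have tele : ∑ k : Fin m, f k.castSucc + f (Fin.last m) = f 0 + ∑ k : Fin m, f k.succ := by
    rw [← Fin.sum_univ_castSucc, Fin.sum_univ_succ]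
  have f0 : f 0 = 0 := by simp [f]
  -- the ascent that starts at `ℓ`, if there is one
  let g : Fin m → ℕ := fun k => if k.castSucc = σ.symm ℓ ∧ ℓ < σ k.succ then 1 else 0
  have step : ∑ k : Fin m, f k.succ + stat2_31At ℓ σ =
      ∑ k : Fin m, f k.castSucc + stat2_13At ℓ σ + ∑ k, g k := by
    rw [stat2_13At_eq_sum, stat2_31At_eq_sum, ← Finset.sum_add_distrib, ← Finset.sum_add_distrib,
      ← Finset.sum_add_distrib]
    refine Finset.sum_congr rfl fun k _ => ?_
    have h1 : σ k.succ = ℓ ↔ k.succ = σ.symm ℓ := (Equiv.eq_symm_apply σ).symm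
    have h2 : σ k.castSucc = ℓ ↔ k.castSucc = σ.symm ℓ := (Equiv.eq_symm_apply σ).symm
    have h3 : (k.succ : ℕ) = (k.castSucc : ℕ) + 1 := by simp
    simp only [f, g]
    simp only [Fin.lt_def, Fin.ext_iff] at *
    generalize (k.succ : ℕ) = a at *
    generalize (k.castSucc : ℕ) = b at *
    generalize (σ k.succ : ℕ) = c at *
    generalize (σ k.castSucc : ℕ) = d at *
    generalize (σ.symm ℓ : ℕ) = e at *
    split_ifs <;> omega
  have hg : ∑ k, g k + (if ℓ = σ (Fin.last m) then 1 else 0) =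
      if ℓ ∈ descentTops σ then 0 else 1 := by
    obtain ⟨p, rfl⟩ := σ.surjective ℓ
    simp only [g, Equiv.symm_apply_apply]
    refine Fin.lastCases ?_ (fun p => ?_) p
    · have : σ (Fin.last m) ∉ descentTops σ := by
        simp [descentTops_eq_image, Fin.castSucc_ne_last]
      simp [this, Fin.castSucc_ne_last]
    · have hm : σ p.castSucc ∈ descentTops σ ↔ σ p.succ < σ p.castSucc := by
        simp [descentTops_eq_image]
      rw [Finset.sum_eq_single p (by simp +contextual) (by simp)]
      have : σ p.succ ≠ σ p.castSucc := fun h => by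
        have := σ.injective h
        simp [Fin.ext_iff] at this
      rcases this.lt_or_gt with h | h
      · simp [hm, h, h.not_gt, Fin.castSucc_ne_last]
      · simp [hm, h, h.not_gt, Fin.castSucc_ne_last]
  have hl : f (Fin.last m) + (if ℓ = σ (Fin.last m) then 1 else 0) =
      if ℓ ≤ σ (Fin.last m) then 1 else 0 := by
    simp only [f]
    rcases lt_trichotomy ℓ (σ (Fin.last m)) with h | h | h
    · have : σ.symm ℓ < Fin.last m := lt_of_le_of_ne (Fin.le_last _) fun h' => by
        rw [Equiv.symm_apply_eq] at h'
        exact h.ne h'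
      simp [h, h.le, h.ne, this]
    · simp [h]
    · simp [h.not_gt, h.not_ge, h.ne']
  omega

theorem last_notMem_descentTops : σ (Fin.last m) ∉ descentTops σ := by
  simp [descentTops_eq_image, Fin.castSucc_ne_last]

theorem stat2_31At_last : stat2_31At (σ (Fin.last m)) σ = 0 := by
  simp [stat2_31At_eq_sum, Fin.not_lt.2 (Fin.le_last _)]

theorem descentBottoms_mem_succ (k : Fin m) :
    σ k.succ ∈ descentBottoms σ ↔ σ k.succ < σ k.castSucc := by
  simp [descentBottoms_eq_image]

end words

/-! ### The Shin–Zeng construction -/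

section construction

variable {m : ℕ} (σ : Equiv.Perm (Fin (m + 1)))

/-- The supply of descent bottoms for the descent top `j`. -/
theorem card_filter_descentBottoms_lt {j : Fin (m + 1)} (hj : j ∈ descentTops σ) :
    ((descentBottoms σ).filter fun x => x < j).card =
      ((descentTops σ).filter fun i => i < j).card + stat31_2At j σ + stat2_31At j σ + 1 := by
  have h1 := stat31_2At_add_stat2_31At σ j
  have h2 := card_descentTops_eq_card_descentBottoms σ
  have h3 := Finset.card_filter_add_card_filter_not (s := descentBottoms σ) fun x => j ≤ x
  have h4 := Finset.card_filter_add_card_filter_not (s := descentTops σ) fun x => j < x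
  have h5 : (descentTops σ).filter (fun x => ¬ j < x) =
      insert j ((descentTops σ).filter fun i => i < j) := by
    ext x
    simp only [Finset.mem_filter, Finset.mem_insert, not_lt, le_iff_lt_or_eq]
    constructor
    · rintro ⟨h, h' | h'⟩
      · exact Or.inr ⟨h, h'⟩
      · exact Or.inl h'
    · rintro (rfl | h)
      · exact ⟨hj, Or.inr rfl⟩
      · exact ⟨h.1, Or.inl h.2⟩
  rw [h5, Finset.card_insert_of_notMem (by simp)] at h4
  simp only [not_le] at h3
  omega

/-- The supply of letters for a letter `j` that is not a descent top. -/
theorem card_filter_compl_descentBottoms_ge (j : Fin (m + 1)) :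
    (((descentBottoms σ)ᶜ).filter fun x => j ≤ x).card =
      (((descentTops σ)ᶜ).filter fun i => j < i).card + stat31_2At j σ + stat2_31At j σ + 1 := by
  have h1 := stat31_2At_add_stat2_31At σ j
  have split : ∀ (s : Finset (Fin (m + 1))) (P : Fin (m + 1) → Prop) [DecidablePred P],
      (s.filter P).card + (sᶜ.filter P).card = (Finset.univ.filter P).card := by
    intro s P _
    rw [← Finset.card_union_of_disjoint, ← Finset.filter_union, Finset.union_compl]
    exact Finset.disjoint_filter_filter disjoint_compl_right
  have h2 := split (descentBottoms σ) fun x => j ≤ x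
  have h3 := split (descentTops σ) fun x => j < x
  have h4 : (Finset.univ.filter fun x : Fin (m + 1) => j ≤ x).card =
      (Finset.univ.filter fun x : Fin (m + 1) => j < x).card + 1 := by
    rw [← Finset.card_insert_of_notMem (a := j) (by simp)]
    congr 1
    ext x
    simp [le_iff_eq_or_lt, eq_comm]
  omega

theorem exists_isSZImage : ∃ τ, IsSZImage σ τ := by
  obtain ⟨f, hf⟩ := exists_greedy_choice (descentTops σ) (descentBottoms σ) (fun j x => x < j)
    (fun j => stat31_2At j σ) fun j hj => by
      rw [card_filter_descentBottoms_lt σ hj]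
      omega
  obtain ⟨g, hg⟩ := exists_greedy_choice_dual (descentTops σ)ᶜ (descentBottoms σ)ᶜ
    (fun j x => j ≤ x) (fun j => stat31_2At j σ) fun j _ => by
      rw [card_filter_compl_descentBottoms_ge σ j]
      omega
  choose! S hS hfS hfr using hf
  choose! T hT hgT hgr using hg
  let t : Fin (m + 1) → Fin (m + 1) := fun j => if j ∈ descentTops σ then f j else g j
  have tf : ∀ j ∈ descentTops σ, t j = f j := fun j hj => if_pos hj
  have tg : ∀ j ∈ (descentTops σ)ᶜ, t j = g j := fun j hj => if_neg (Finset.mem_compl.1 hj)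
  have bottom : ∀ j, t j ∈ descentBottoms σ ↔ j ∈ descentTops σ := by
    intro j
    by_cases hj : j ∈ descentTops σ
    · rw [tf j hj]
      exact iff_of_true ((hS j hj _).1 (hfS j hj)).1 hj
    · have hj' := Finset.mem_compl.2 hj
      rw [tg j hj']
      exact iff_of_false (Finset.mem_compl.1 ((hT j hj' _).1 (hgT j hj')).1) hj
  have inj : Function.Injective t := by
    intro i j hij
    wlog h : i < j generalizing i j
    · rcases (not_lt.1 h).lt_or_eq with h | h
      · exact (this hij.symm h).symm
      · exact h.symm
    exfalso
    have hmem : i ∈ descentTops σ ↔ j ∈ descentTops σ := by rw [← bottom, ← bottom, hij]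
    by_cases hj : j ∈ descentTops σ
    · have hi := hmem.2 hj
      rw [tf i hi, tf j hj] at hij
      exact ((hS j hj _).1 (hfS j hj)).2.2 i hi h hij
    · have hi := Finset.mem_compl.2 fun hi => hj (hmem.1 hi)
      replace hj := Finset.mem_compl.2 hj
      rw [tg i hi, tg j hj] at hij
      exact ((hT i hi _).1 (hgT i hi)).2.2 j hj h hij.symm
  let τ : Equiv.Perm (Fin (m + 1)) := Equiv.ofBijective t (Finite.injective_iff_bijective.1 inj)
  have hτ : ∀ j, τ j = t j := fun _ => rfl
  refine ⟨τ, fun j hj => ?_, fun j hj => ?_⟩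
  · have e : availableLower σ τ j = S j := by
      ext x
      rw [availableLower, Finset.mem_filter, hS j hj]
      refine and_congr_right fun _ => and_congr_right fun _ => ?_
      exact forall₂_congr fun i hi => by rw [hτ, tf i hi]
    rw [e, hτ, tf j hj]
    exact ⟨hfS j hj, hfr j hj⟩
  · have e : availableUpper σ τ j = T j := by
      ext x
      rw [availableUpper, Finset.mem_filter, hT j hj]
      refine and_congr_right fun _ => and_congr_right fun _ => ?_
      exact forall₂_congr fun i hi => by rw [hτ, tg i hi]
    rw [e, hτ, tg j hj]
    exact ⟨hgT j hj, hgr j hj⟩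

end construction

theorem isSZImage_unique {n : ℕ} {σ τ τ' : Equiv.Perm (Fin n)} (h : IsSZImage σ τ)
    (h' : IsSZImage σ τ') : τ = τ' := by
  have lower : ∀ j, j ∈ descentTops σ → τ j = τ' j := by
    intro j
    induction j using WellFoundedLT.induction with
    | ind j ih =>
      intro hj
      have e : availableLower σ τ j = availableLower σ τ' j := by
        refine Finset.filter_congr fun x _ => and_congr_right fun _ => ?_
        exact forall₃_congr fun i hi hij => by rw [ih i hij hi]
      have h1 := h.1 j hj
      have h2 := h'.1 j hj
      rw [← e] at h2
      exact card_filter_lt_injOn _ h1.1 h2.1 (h1.2.trans h2.2.symm)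
  have upper : ∀ j, j ∈ (descentTops σ)ᶜ → τ j = τ' j := by
    intro j
    induction j using WellFoundedGT.induction with
    | ind j ih =>
      intro hj
      have e : availableUpper σ τ j = availableUpper σ τ' j := by
        refine Finset.filter_congr fun x _ => and_congr_right fun _ => ?_
        exact forall₃_congr fun i hi hij => by rw [ih i hij hi]
      have h1 := h.2 j hj
      have h2 := h'.2 j hj
      rw [← e] at h2
      exact card_filter_lt_injOn (α := (Fin n)ᵒᵈ) _ h1.1 h2.1 (h1.2.trans h2.2.symm)
  ext j
  by_cases hj : j ∈ descentTops σ
  · rw [lower j hj]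
  · rw [upper j (Finset.mem_compl.2 hj)]

theorem existsUnique_isSZImage {n : ℕ} (σ : Equiv.Perm (Fin n)) : ∃! τ, IsSZImage σ τ := by
  cases n with
  | zero => exact ⟨1, ⟨fun j => j.elim0, fun j => j.elim0⟩, fun _ _ => Subsingleton.elim _ _⟩
  | succ m =>
    obtain ⟨τ, h⟩ := exists_isSZImage σ
    exact ⟨τ, h, fun _ h' => isSZImage_unique h' h⟩

theorem isSZImage_phiSZ {n : ℕ} (σ : Equiv.Perm (Fin n)) : IsSZImage σ (phiSZ σ) :=
  Classical.epsilon_spec (existsUnique_isSZImage σ).exists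

/-! ### Crossings of the Shin–Zeng image -/

/-- The number of crossings of the permutation `τ`, drawn as the arcs `i → τ i`, that are assigned
to the arc of `j`. Two arcs of the same direction cross in the sense of Corteel, where a weak
excedance `i ≤ τ i` also crosses a weak excedance that starts at its target. The crossing is assigned
to the arc with the larger source if the arcs are weak excedances, and to the one with the smaller
source otherwise. -/
def crossingsAt {n : ℕ} (j : Fin n) (τ : Equiv.Perm (Fin n)) : ℕ :=
  if τ j < j then (Finset.univ.filter fun i => τ j < τ i ∧ τ i < j ∧ j < i).card
  else (Finset.univ.filter fun i => i < j ∧ j ≤ τ i ∧ τ i < τ j).card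

/-- The number of arcs `i → τ i` that pass from below `j` to a point not below `j`. -/
def coverAt {n : ℕ} (j : Fin n) (τ : Equiv.Perm (Fin n)) : ℕ :=
  (Finset.univ.filter fun i => i < j ∧ j ≤ τ i).card

theorem card_filter_symm_apply {n : ℕ} (τ : Equiv.Perm (Fin n)) (P : Fin n → Prop)
    [DecidablePred P] :
    (Finset.univ.filter fun i => P (τ i)).card = (Finset.univ.filter P).card := by
  simp only [Finset.card_filter]
  exact Equiv.sum_comp τ fun i => if P i then 1 else 0

/-- A permutation moves as many letters up across a threshold as down. -/
theorem coverAt_eq_card_down {n : ℕ} (j : Fin n) (τ : Equiv.Perm (Fin n)) :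
    coverAt j τ = (Finset.univ.filter fun i => τ i < j ∧ j ≤ i).card := by
  have h := card_filter_symm_apply τ fun i => j ≤ i
  have h1 : coverAt j τ + (Finset.univ.filter fun i => j ≤ i ∧ j ≤ τ i).card =
      (Finset.univ.filter fun i => j ≤ τ i).card := by
    simp only [coverAt, Finset.card_filter, ← Finset.sum_add_distrib]
    refine Finset.sum_congr rfl fun i _ => ?_
    split_ifs <;> omega
  have h2 : (Finset.univ.filter fun i => τ i < j ∧ j ≤ i).card +
      (Finset.univ.filter fun i => j ≤ i ∧ j ≤ τ i).card =
      (Finset.univ.filter fun i => j ≤ i).card := by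
    simp only [Finset.card_filter, ← Finset.sum_add_distrib]
    refine Finset.sum_congr rfl fun i _ => ?_
    split_ifs <;> omega
  omega

namespace VincularPatterns.IsSZImage

variable {n : ℕ} {σ τ : Equiv.Perm (Fin n)}

theorem mem_descentTops_iff (h : IsSZImage σ τ) (j : Fin n) : j ∈ descentTops σ ↔ τ j < j := by
  by_cases hj : j ∈ descentTops σ
  · exact iff_of_true hj (Finset.mem_filter.1 (h.1 j hj).1).2.1
  · exact iff_of_false hj
      (Finset.mem_filter.1 (h.2 j (Finset.mem_compl.2 hj)).1).2.1.not_gt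

theorem apply_mem_descentBottoms_iff (h : IsSZImage σ τ) (j : Fin n) :
    τ j ∈ descentBottoms σ ↔ τ j < j := by
  rw [← h.mem_descentTops_iff]
  by_cases hj : j ∈ descentTops σ
  · exact iff_of_true (Finset.mem_filter.1 (h.1 j hj).1).1 hj
  · exact iff_of_false (Finset.mem_compl.1
      (Finset.mem_filter.1 (h.2 j (Finset.mem_compl.2 hj)).1).1) hj

/-- The free entries passed over in the choice of `τ j` are chosen later in the construction, by the
arcs that cross the arc of `j`. -/
theorem stat31_2At_eq (h : IsSZImage σ τ) (j : Fin n) : stat31_2At j σ = crossingsAt j τ := by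
  have hF := h.mem_descentTops_iff
  have hB := h.apply_mem_descentBottoms_iff
  unfold crossingsAt
  split_ifs with hj
  · rw [← (h.1 j ((hF j).2 hj)).2]
    symm
    rw [← Finset.card_map τ.toEmbedding]
    congr 1
    ext y
    obtain ⟨i, rfl⟩ := τ.surjective y
    simp only [availableLower, Finset.mem_filter, Finset.mem_map, Finset.mem_univ, true_and,
      Equiv.coe_toEmbedding, EmbeddingLike.apply_eq_iff_eq, exists_eq_right, hB, hF, ne_eq]
    symm
    constructor
    · rintro ⟨⟨h1, h2, h3⟩, h4⟩
      refine ⟨h4, h2, lt_of_le_of_ne (not_lt.1 fun hij => h3 i h1 hij rfl) ?_⟩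
      rintro rfl
      exact lt_irrefl _ h4
    · rintro ⟨h1, h2, h3⟩
      refine ⟨⟨h2.trans h3, h2, ?_⟩, h1⟩
      rintro k _ hk rfl
      exact lt_asymm hk h3
  · rw [← (h.2 j (Finset.mem_compl.2 fun hj' => hj ((hF j).1 hj'))).2]
    symm
    rw [← Finset.card_map τ.toEmbedding]
    congr 1
    ext y
    obtain ⟨i, rfl⟩ := τ.surjective y
    simp only [availableUpper, Finset.mem_filter, Finset.mem_map, Finset.mem_univ, true_and,
      Equiv.coe_toEmbedding, EmbeddingLike.apply_eq_iff_eq, exists_eq_right, hB, hF, ne_eq,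
      Finset.mem_compl, not_lt]
    symm
    constructor
    · rintro ⟨⟨h1, h2, h3⟩, h4⟩
      refine ⟨lt_of_le_of_ne (not_lt.1 fun hij => h3 i h1 hij rfl) ?_, h2, h4⟩
      rintro rfl
      exact lt_irrefl _ h4
    · rintro ⟨h1, h2, h3⟩
      refine ⟨⟨(h1.le.trans h2), h2, ?_⟩, h3⟩
      rintro k _ hk rfl
      exact lt_asymm hk h1

end VincularPatterns.IsSZImage

section image

variable {m : ℕ} {σ τ : Equiv.Perm (Fin (m + 1))}

/-- There are as many descents of `σ` over `j` as arcs that lead from above `j` to below `j`; the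
arc that starts at `j` is counted by `coverAt` only. -/
theorem stat31_2At_add_stat2_31At_eq_coverAt (h : IsSZImage σ τ) (j : Fin (m + 1)) :
    stat31_2At j σ + stat2_31At j σ + (if τ j < j then 1 else 0) = coverAt j τ := by
  have h1 := stat31_2At_add_stat2_31At σ j
  have h2 : ((descentBottoms σ).filter fun x => j ≤ x).card =
      ∑ i, if τ i < i ∧ j ≤ τ i then 1 else 0 := by
    rw [← Finset.card_filter]
    symm
    rw [← Finset.card_map τ.toEmbedding]
    congr 1
    ext y
    obtain ⟨i, rfl⟩ := τ.surjective y
    simp [h.apply_mem_descentBottoms_iff]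
  have h3 : ((descentTops σ).filter fun x => j < x).card =
      ∑ i, if τ i < i ∧ j < i then 1 else 0 := by
    rw [← Finset.card_filter]
    congr 1
    ext i
    simp [h.mem_descentTops_iff]
  have h4 : (if τ j < j then 1 else 0) = ∑ i, if i = j then (if τ j < j then 1 else 0) else 0 := by
    simp
  have h5 : (∑ i, if τ i < i ∧ j < i then 1 else 0) + (if τ j < j then 1 else 0) =
      coverAt j τ + ∑ i, if τ i < i ∧ j ≤ τ i then 1 else 0 := by
    rw [coverAt_eq_card_down, Finset.card_filter, h4, ← Finset.sum_add_distrib,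
      ← Finset.sum_add_distrib]
    refine Finset.sum_congr rfl fun i _ => ?_
    by_cases hi : i = j
    · subst hi
      split_ifs <;> omega
    · split_ifs <;> omega
  omega

/-- The last letter `a` of `σ` and the letter `j` with `τ j = n` coincide: both are the largest
letter `ℓ` that is not a descent top and has `2-31`-statistic zero. -/
theorem apply_last_eq_last (h : IsSZImage σ τ) : τ (σ (Fin.last m)) = Fin.last m := by
  obtain ⟨j, hj⟩ := τ.surjective (Fin.last m)
  set a := σ (Fin.last m) with ha
  suffices a = j by rw [this, hj]
  have hjG : ¬ τ j < j := by rw [hj]; exact (Fin.le_last _).not_gt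
  rcases lt_trichotomy j a with hlt | heq | hgt
  · -- the arc of `j` covers that of `a` and is not counted by the crossings of `a`
    exfalso
    have haG : ¬ τ a < a := fun h' => last_notMem_descentTops σ ((h.mem_descentTops_iff a).2 h')
    have h1 := stat31_2At_add_stat2_31At_eq_coverAt h a
    rw [h.stat31_2At_eq, if_neg haG, ha, stat2_31At_last, ← ha, crossingsAt, if_neg haG,
      coverAt] at h1
    refine h1.not_lt (Finset.card_lt_card ⟨fun i => ?_, fun hsub => ?_⟩)
    · simp only [Finset.mem_filter]
      tauto
    · have := hsub (Finset.mem_filter.2 ⟨Finset.mem_univ j, hlt, hj ▸ Fin.le_last _⟩)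
      simp [hj, Fin.not_lt.2 (Fin.le_last _)] at this
  · exact heq.symm
  · exfalso
    have h1 := stat31_2At_add_stat2_31At_eq_coverAt h j
    have h2 := stat2_13At_add_ite σ j
    rw [if_neg (fun h' => hjG ((h.mem_descentTops_iff j).1 h')), ← ha, if_neg hgt.not_ge] at h2
    rw [h.stat31_2At_eq, if_neg hjG, crossingsAt, if_neg hjG, coverAt] at h1
    have h3 : (Finset.univ.filter fun i => i < j ∧ j ≤ τ i ∧ τ i < τ j) =
        Finset.univ.filter fun i => i < j ∧ j ≤ τ i := by
      refine Finset.filter_congr fun i _ => ⟨fun h => ⟨h.1, h.2.1⟩, fun h => ⟨h.1, h.2, ?_⟩⟩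
      rw [hj]
      refine lt_of_le_of_ne (Fin.le_last _) fun h' => h.1.ne ?_
      exact τ.injective (h'.trans hj.symm)
    rw [h3] at h1
    omega

end image

/-! ### Injectivity -/

section injectivity

variable {m : ℕ} {σ σ' : Equiv.Perm (Fin (m + 1))} {k : Fin m}

/-- If two words agree after position `k` but not at it, the letter of the first word at position `k`
stands further left in the second word. -/
theorem symm_apply_lt_castSucc (hk : ∀ j, k.succ ≤ j → σ j = σ' j)
    (hne : σ k.castSucc ≠ σ' k.castSucc) : σ'.symm (σ k.castSucc) < k.castSucc := by
  by_contra! h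
  rcases h.lt_or_eq with h | h
  · have h1 := hk _ (Fin.castSucc_lt_iff_succ_le.1 h)
    rw [Equiv.apply_symm_apply, EmbeddingLike.apply_eq_iff_eq] at h1
    exact h.ne' h1
  · exact hne ((Equiv.eq_symm_apply σ').1 h).symm

/-- In `σ'` the letter `σ k` stands to the left of position `k`, so that the descent at `k`
passes over it on its right, in addition to the descents that both words have after `k`. -/
theorem stat2_31At_lt_of_agree (hk : ∀ j, k.succ ≤ j → σ j = σ' j)
    (h1 : σ k.castSucc < σ' k.castSucc) (h2 : σ' k.succ < σ k.castSucc) :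
    stat2_31At (σ k.castSucc) σ < stat2_31At (σ k.castSucc) σ' := by
  have hp := symm_apply_lt_castSucc hk h1.ne
  rw [stat2_31At_eq_sum, stat2_31At_eq_sum]
  refine Finset.sum_lt_sum (fun j _ => ?_) ⟨k, Finset.mem_univ _, ?_⟩
  · rw [Equiv.symm_apply_apply]
    by_cases hj : k.castSucc < j.castSucc
    · have hj' := Fin.castSucc_lt_iff_succ_le.1 hj
      rw [hk _ hj', hk j.succ (hj'.trans (Fin.castSucc_lt_succ).le)]
      simp [hj, hp.trans hj]
    · simp [hj]
  · simp [hp, h1, h2]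

theorem stat2_13At_lt_of_agree (hk : ∀ j, k.succ ≤ j → σ j = σ' j)
    (h1 : σ' k.castSucc < σ k.castSucc) (h2 : σ k.castSucc < σ' k.succ) :
    stat2_13At (σ k.castSucc) σ < stat2_13At (σ k.castSucc) σ' := by
  have hp := symm_apply_lt_castSucc hk h1.ne'
  rw [stat2_13At_eq_sum, stat2_13At_eq_sum]
  refine Finset.sum_lt_sum (fun j _ => ?_) ⟨k, Finset.mem_univ _, ?_⟩
  · rw [Equiv.symm_apply_apply]
    by_cases hj : k.castSucc < j.castSucc
    · have hj' := Fin.castSucc_lt_iff_succ_le.1 hj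
      rw [hk _ hj', hk j.succ (hj'.trans (Fin.castSucc_lt_succ).le)]
      simp [hj, hp.trans hj]
    · simp [hj]
  · simp [hp, h1, h2]

/-- A word is read off from right to left: if the suffix after a position is known, the letter at
that position is decided by whether its right neighbour is a descent bottom, and by the
`2-31`-statistics (for a descent) or the `2-13`-statistics (for an ascent) of the letters. -/
theorem eq_of_descentBottoms_eq (hB : descentBottoms σ = descentBottoms σ')
    (h31 : ∀ ℓ, stat2_31At ℓ σ = stat2_31At ℓ σ') (h13 : ∀ ℓ, stat2_13At ℓ σ = stat2_13At ℓ σ')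
    (hlast : σ (Fin.last m) = σ' (Fin.last m)) : σ = σ' := by
  have key : ∀ i j, i ≤ j → σ j = σ' j := by
    intro i
    induction i using Fin.reverseInduction with
    | last =>
      intro j hj
      rw [Fin.last_le_iff.1 hj, hlast]
    | cast k ih =>
      suffices σ k.castSucc = σ' k.castSucc by
        intro j hj
        rcases hj.eq_or_lt with rfl | hj
        · exact this
        · exact ih j (Fin.castSucc_lt_iff_succ_le.1 hj)
      have hs := ih k.succ le_rfl
      have hd : σ k.succ < σ k.castSucc ↔ σ' k.succ < σ' k.castSucc := by
        rw [← descentBottoms_mem_succ, ← descentBottoms_mem_succ, hs, hB]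
      have ne : ∀ ρ : Equiv.Perm (Fin (m + 1)), ρ k.castSucc ≠ ρ k.succ := fun ρ h =>
        (Fin.castSucc_lt_succ (i := k)).ne (ρ.injective h)
      have ih' : ∀ j, k.succ ≤ j → σ' j = σ j := fun j hj => (ih j hj).symm
      by_contra hne
      by_cases h : σ k.succ < σ k.castSucc
      · have h' := hd.1 h
        rcases lt_or_gt_of_ne hne with hlt | hlt
        · exact (stat2_31At_lt_of_agree ih hlt (hs ▸ h)).ne (h31 _)
        · exact (stat2_31At_lt_of_agree ih' hlt (hs ▸ h')).ne (h31 _).symm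
      · have h' := fun h' => h (hd.2 h')
        replace h := lt_of_le_of_ne (not_lt.1 h) (ne σ)
        replace h' := lt_of_le_of_ne (not_lt.1 h') (ne σ')
        rcases lt_or_gt_of_ne hne with hlt | hlt
        · exact (stat2_13At_lt_of_agree ih' hlt (hs ▸ h')).ne (h13 _).symm
        · exact (stat2_13At_lt_of_agree ih hlt (hs ▸ h)).ne (h13 _)
  ext i
  rw [key i i le_rfl]

/-- The image `τ` recovers the descent tops, the descent bottoms, the last letter and the
`31-2`-statistics of `σ`, and with them the data from which the word is read off. -/
theorem eq_of_isSZImage {τ : Equiv.Perm (Fin (m + 1))} (h : IsSZImage σ τ)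
    (h' : IsSZImage σ' τ) : σ = σ' := by
  have hF : descentTops σ = descentTops σ' := by
    ext j
    rw [h.mem_descentTops_iff, h'.mem_descentTops_iff]
  have hB : descentBottoms σ = descentBottoms σ' := by
    ext x
    obtain ⟨j, rfl⟩ := τ.surjective x
    rw [h.apply_mem_descentBottoms_iff, h'.apply_mem_descentBottoms_iff]
  have hlast : σ (Fin.last m) = σ' (Fin.last m) :=
    τ.injective ((apply_last_eq_last h).trans (apply_last_eq_last h').symm)
  have h31 : ∀ ℓ, stat2_31At ℓ σ = stat2_31At ℓ σ' := by
    intro ℓ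
    have h1 := stat31_2At_add_stat2_31At_eq_coverAt h ℓ
    have h2 := stat31_2At_add_stat2_31At_eq_coverAt h' ℓ
    rw [h.stat31_2At_eq] at h1
    rw [h'.stat31_2At_eq] at h2
    omega
  refine eq_of_descentBottoms_eq hB h31 (fun ℓ => ?_) hlast
  have h1 := stat2_13At_add_ite σ ℓ
  have h2 := stat2_13At_add_ite σ' ℓ
  rw [hF, h31, hlast] at h1
  omega

end injectivity

theorem phiSZ_bijective (n : ℕ) : Function.Bijective (phiSZ (n := n)) := by
  refine Finite.injective_iff_bijective.1 fun σ σ' h => ?_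
  cases n with
  | zero => exact Subsingleton.elim _ _
  | succ m => exact eq_of_isSZImage (isSZImage_phiSZ σ) (h ▸ isSZImage_phiSZ σ')

/-! ### The statistics under the map `θ̂` -/

/-- The subtraction is truncated, so that only the excedances of `τ` contribute. -/
theorem sum_coverAt_eq_sum_sub {n : ℕ} (τ : Equiv.Perm (Fin n)) :
    ∑ j, coverAt j τ = ∑ i : Fin n, ((τ i : ℕ) - i) := by
  simp only [coverAt, Finset.card_filter]
  rw [Finset.sum_comm]
  refine Finset.sum_congr rfl fun i _ => ?_
  rw [← Finset.card_filter, ← Fin.card_Ioc]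
  congr 1
  ext j
  simp

/-- The subtraction is truncated, so that only the letters `i` with `τ i < i` contribute. -/
theorem sum_coverAt_eq_sum_sub' {n : ℕ} (τ : Equiv.Perm (Fin n)) :
    ∑ j, coverAt j τ = ∑ i : Fin n, ((i : ℕ) - τ i) := by
  simp only [coverAt_eq_card_down, Finset.card_filter]
  rw [Finset.sum_comm]
  refine Finset.sum_congr rfl fun i _ => ?_
  rw [← Finset.card_filter, ← Fin.card_Ioc]
  congr 1
  ext j
  simp

section theta

variable {m : ℕ} (τ : Equiv.Perm (Fin (m + 1)))

theorem val_thetaHat_rev (i : Fin (m + 1)) :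
    (thetaHat τ i.rev : ℕ) = if (τ i : ℕ) < m then m - 1 - (τ i : ℕ) else m := by
  have h : thetaHat τ i.rev = hatLetter (τ i) := by simp [thetaHat]
  have := (τ i).isLt
  rw [h, hatLetter]
  split_ifs with h1 h2 h2 <;> first | omega | (simp only; omega)

theorem thetaHat_involutive : Function.Involutive (thetaHat (n := m + 1)) := by
  intro τ
  ext i
  simp [thetaHat, hatLetter_involutive _]

theorem thetaHat_symm_last : (thetaHat τ).symm (Fin.last m) = (τ.symm (Fin.last m)).rev := by
  rw [Equiv.symm_apply_eq]
  ext
  simp [val_thetaHat_rev]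

theorem card_filter_rev {n : ℕ} (P : Fin n → Prop) [DecidablePred P] :
    (Finset.univ.filter P).card = (Finset.univ.filter fun i : Fin n => P i.rev).card :=
  (card_filter_symm_apply Fin.revPerm P).symm

/-- The map `θ̂` turns the arc of `j` into one of `rev j` and reverses the order of sources and targets,
with a shift by one that exchanges the weak excedances, except the arc into the largest letter, with
the other arcs. -/
theorem crossingsAt_thetaHat (j : Fin (m + 1)) :
    crossingsAt j.rev (thetaHat τ) = crossingsAt j τ := by
  have hv := val_thetaHat_rev τ
  have hr : ∀ i : Fin (m + 1), (i.rev : ℕ) = m - i := fun i => by rw [Fin.val_rev]; omega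
  have hj := hv j
  have hjr := hr j
  have hjm := j.isLt
  by_cases hτ : (τ j : ℕ) < m
  · unfold crossingsAt
    rw [if_pos hτ] at hj
    simp only [Fin.lt_def, Fin.le_def, hj, hjr]
    by_cases h : (τ j : ℕ) < j
    · rw [if_neg (by omega), if_pos h, card_filter_rev]
      congr 1
      refine Finset.filter_congr fun i _ => ?_
      rw [hv i, hr i]
      have := i.isLt
      split_ifs <;> omega
    · rw [if_pos (by omega), if_neg h, card_filter_rev]
      congr 1
      refine Finset.filter_congr fun i _ => ?_
      rw [hv i, hr i]
      have := i.isLt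
      split_ifs <;> omega
  · -- the arc that ends in the largest letter is crossed by all arcs that pass over its source
    have hτm : (τ j : ℕ) = m := by have := (τ j).isLt; omega
    have hlt : ∀ i, i ≠ j → (τ i : ℕ) < m := fun i hi => by
      have h1 : (τ i : ℕ) ≠ τ j := fun h => hi (τ.injective (Fin.ext h))
      have := (τ i).isLt
      omega
    rw [if_neg hτ] at hj
    have e : crossingsAt j τ = coverAt j τ := by
      rw [crossingsAt, coverAt, if_neg (by rw [Fin.lt_def]; omega)]
      congr 1
      refine Finset.filter_congr fun i _ => ?_
      simp only [Fin.lt_def, Fin.le_def, hτm]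
      refine ⟨fun h => ⟨h.1, h.2.1⟩, fun h => ⟨h.1, h.2, hlt i fun h' => ?_⟩⟩
      rw [h'] at h
      omega
    rw [e, coverAt_eq_card_down, crossingsAt, if_neg (by rw [Fin.lt_def]; omega), card_filter_rev]
    congr 1
    refine Finset.filter_congr fun i _ => ?_
    simp only [Fin.lt_def, Fin.le_def]
    rw [hv i, hr i, hj, hjr]
    by_cases hi : i = j
    · subst hi
      split_ifs
      omega
    · have h1 := hlt i hi
      have h2 : (i : ℕ) ≠ j := fun h => hi (Fin.ext h)
      have := i.isLt
      rw [if_pos h1]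
      omega

theorem card_drops_thetaHat :
    (Finset.univ.filter fun i => thetaHat τ i < i).card +
      (Finset.univ.filter fun i => τ i < i).card = m := by
  have h : (Finset.univ.filter fun i => thetaHat τ i < i).card +
      (Finset.univ.filter fun i => τ i < i).card +
      ∑ i, (if i = τ.symm (Fin.last m) then 1 else 0) = ∑ i : Fin (m + 1), 1 := by
    rw [card_filter_rev]
    simp only [Finset.card_filter]
    rw [← Finset.sum_add_distrib, ← Finset.sum_add_distrib]
    refine Finset.sum_congr rfl fun i _ => ?_
    simp only [Equiv.eq_symm_apply, Fin.lt_def, Fin.ext_iff, Fin.val_last]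
    rw [val_thetaHat_rev, Fin.val_rev]
    have := i.isLt
    have := (τ i).isLt
    split_ifs <;> omega
  simp at h
  omega

/-- Turning an arc over shortens it or lengthens it by one according to its direction; the arc into the
largest letter is the exception that brings in its source. -/
theorem sum_coverAt_thetaHat :
    ∑ j, coverAt j (thetaHat τ) + (Finset.univ.filter fun i => τ i < i).card =
      ∑ j, coverAt j τ + (τ.symm (Fin.last m) : ℕ) := by
  set a := τ.symm (Fin.last m) with ha
  have h : ∑ j, coverAt j (thetaHat τ) + (Finset.univ.filter fun i => τ i < i).card +
      ∑ i, (if i = a then m + 1 - (a : ℕ) else 0) =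
      ∑ j, coverAt j τ + ∑ i : Fin (m + 1), 1 := by
    rw [sum_coverAt_eq_sum_sub', sum_coverAt_eq_sum_sub, Finset.card_filter,
      ← Equiv.sum_comp Fin.revPerm,
      ← Finset.sum_add_distrib, ← Finset.sum_add_distrib, ← Finset.sum_add_distrib]
    refine Finset.sum_congr rfl fun i _ => ?_
    have hi : i = a ↔ (τ i : ℕ) = m := by rw [ha, Equiv.eq_symm_apply, Fin.ext_iff, Fin.val_last]
    have := i.isLt
    have := (τ i).isLt
    rw [Fin.revPerm_apply, val_thetaHat_rev, Fin.val_rev]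
    simp only [Fin.lt_def]
    by_cases h : i = a
    · have := hi.1 h
      rw [if_pos h, ← h]
      split_ifs <;> omega
    · have := fun h' => h (hi.2 h')
      rw [if_neg h]
      split_ifs <;> omega
  have := a.isLt
  simp at h
  omega

end theta

section totals

variable {m : ℕ} {σ τ : Equiv.Perm (Fin (m + 1))}

theorem stat31_2_eq_sum_crossingsAt (h : IsSZImage σ τ) : stat31_2 σ = ∑ j, crossingsAt j τ :=
  Finset.sum_congr rfl fun j _ => h.stat31_2At_eq j

theorem stat31_2_add_stat2_31 (h : IsSZImage σ τ) :
    stat31_2 σ + stat2_31 σ + (Finset.univ.filter fun i => τ i < i).card = ∑ j, coverAt j τ := by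
  rw [stat31_2, stat2_31, Finset.card_filter, ← Finset.sum_add_distrib, ← Finset.sum_add_distrib]
  exact Finset.sum_congr rfl fun j _ => stat31_2At_add_stat2_31At_eq_coverAt h j

/-- By `apply_last_eq_last`, the source of the arc into the largest letter is the last letter of `σ`. -/
theorem stat2_13_add (h : IsSZImage σ τ) :
    stat2_13 σ + (m + 1) = stat2_31 σ + (Finset.univ.filter fun i => τ i < i).card +
      ((τ.symm (Fin.last m) : ℕ) + 1) := by
  have hlast : τ.symm (Fin.last m) = σ (Fin.last m) :=
    (Equiv.symm_apply_eq τ).2 (apply_last_eq_last h).symm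
  have h1 : ∑ ℓ, (stat2_13At ℓ σ + 1) = ∑ ℓ, (stat2_31At ℓ σ + (if τ ℓ < ℓ then 1 else 0) +
      if ℓ ≤ σ (Fin.last m) then 1 else 0) := by
    refine Finset.sum_congr rfl fun ℓ _ => ?_
    have := stat2_13At_add_ite σ ℓ
    simp only [h.mem_descentTops_iff] at this
    split_ifs at * <;> omega
  have h2 : (Finset.univ.filter fun ℓ => ℓ ≤ σ (Fin.last m)).card = (σ (Fin.last m) : ℕ) + 1 := by
    rw [← Fin.card_Iic]
    congr 1
    ext
    simp
  simp only [Finset.sum_add_distrib, ← Finset.card_filter, h2] at h1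
  simpa [hlast, stat2_13, stat2_31] using h1

theorem stat_eq_of_thetaHat {σ' : Equiv.Perm (Fin (m + 1))} (h : IsSZImage σ τ)
    (h' : IsSZImage σ' (thetaHat τ)) : stat31_2 σ = stat31_2 σ' ∧ stat2_31 σ = stat2_13 σ' := by
  have hC : stat31_2 σ = stat31_2 σ' := by
    rw [stat31_2_eq_sum_crossingsAt h, stat31_2_eq_sum_crossingsAt h', ← Equiv.sum_comp Fin.revPerm
      fun j => crossingsAt j (thetaHat τ)]
    exact Finset.sum_congr rfl fun j _ => (crossingsAt_thetaHat τ j).symm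
  refine ⟨hC, ?_⟩
  have h1 := stat31_2_add_stat2_31 h
  have h2 := stat31_2_add_stat2_31 h'
  have h3 := stat2_13_add h'
  have h4 := card_drops_thetaHat τ
  have h5 := sum_coverAt_thetaHat τ
  have h6 := (τ.symm (Fin.last m)).isLt
  rw [thetaHat_symm_last, Fin.val_rev] at h3
  omega

end totals

theorem phiSZ_phiHat {n : ℕ} (σ : Equiv.Perm (Fin n)) :
    phiSZ (phiHat σ) = thetaHat (phiSZ σ) :=
  Function.rightInverse_invFun (phiSZ_bijective n).2 _

theorem phiHat_involutive (n : ℕ) : Function.Involutive (phiHat (n := n)) := by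
  intro σ
  cases n with
  | zero => exact Subsingleton.elim _ _
  | succ m =>
    apply (phiSZ_bijective _).1
    rw [phiSZ_phiHat, phiSZ_phiHat, thetaHat_involutive]

theorem stat_phiHat {n : ℕ} (σ : Equiv.Perm (Fin n)) :
    stat31_2 σ = stat31_2 (phiHat σ) ∧ stat2_31 σ = stat2_13 (phiHat σ) := by
  cases n with
  | zero => simp [stat31_2, stat2_31, stat2_13]
  | succ m =>
    exact stat_eq_of_thetaHat (isSZImage_phiSZ σ) (phiSZ_phiHat σ ▸ isSZImage_phiSZ (phiHat σ))

/-! ### Reversal, complement and the polynomial relations -/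

section symmetries

variable {n : ℕ} (σ : Equiv.Perm (Fin n))

theorem exists_rev_val_eq_add_one (j : Fin n) (P : Fin n → Prop) :
    (∃ k : Fin n, (j.rev : ℕ) = k + 1 ∧ P k) ↔ ∃ k : Fin n, (k : ℕ) = j + 1 ∧ P k.rev := by
  simp only [Fin.val_rev]
  constructor
  · rintro ⟨k, hk, h⟩
    refine ⟨k.rev, ?_, by rwa [Fin.rev_rev]⟩
    rw [Fin.val_rev]
    omega
  · rintro ⟨k, hk, h⟩
    refine ⟨k.rev, ?_, h⟩
    rw [Fin.val_rev]
    omega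

theorem symm_mul_rev (ℓ : Fin n) : (σ * Fin.revPerm).symm ℓ = (σ.symm ℓ).rev := by
  simp [Equiv.symm_apply_eq]

theorem stat13_2_mul_rev : stat13_2 (σ * Fin.revPerm) = stat2_31 σ := by
  refine Finset.sum_congr rfl fun ℓ _ => ?_
  rw [stat13_2At, stat2_31At, card_filter_rev]
  congr 1
  refine Finset.filter_congr fun j _ => ?_
  rw [exists_rev_val_eq_add_one, symm_mul_rev, Fin.rev_lt_rev]
  simp

theorem stat31_2_mul_rev : stat31_2 (σ * Fin.revPerm) = stat2_13 σ := by
  refine Finset.sum_congr rfl fun ℓ _ => ?_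
  rw [stat31_2At, stat2_13At, card_filter_rev]
  congr 1
  refine Finset.filter_congr fun j _ => ?_
  rw [exists_rev_val_eq_add_one, symm_mul_rev, Fin.rev_lt_rev]
  simp

theorem mul_rev_mul_rev : σ * Fin.revPerm * Fin.revPerm = σ := by
  ext
  simp

theorem stat2_31_mul_rev : stat2_31 (σ * Fin.revPerm) = stat13_2 σ := by
  rw [← stat13_2_mul_rev, mul_rev_mul_rev]

theorem stat2_13_mul_rev : stat2_13 (σ * Fin.revPerm) = stat31_2 σ := by
  rw [← stat31_2_mul_rev, mul_rev_mul_rev]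

theorem symm_rev_mul (ℓ : Fin n) : (Fin.revPerm * σ).symm ℓ.rev = σ.symm ℓ := by
  simp [Equiv.symm_apply_eq]

theorem stat13_2_rev_mul : stat13_2 (Fin.revPerm * σ) = stat31_2 σ := by
  rw [stat13_2, ← Equiv.sum_comp Fin.revPerm]
  refine Finset.sum_congr rfl fun ℓ _ => ?_
  simp [stat13_2At, stat31_2At, symm_rev_mul, and_comm]

theorem stat2_13_rev_mul : stat2_13 (Fin.revPerm * σ) = stat2_31 σ := by
  rw [stat2_13, ← Equiv.sum_comp Fin.revPerm]
  refine Finset.sum_congr rfl fun ℓ _ => ?_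
  simp [stat2_13At, stat2_31At, symm_rev_mul, and_comm]

theorem rev_mul_rev_mul : Fin.revPerm * (Fin.revPerm * σ) = σ := by
  ext
  simp

theorem stat31_2_rev_mul : stat31_2 (Fin.revPerm * σ) = stat13_2 σ := by
  rw [← stat13_2_rev_mul, rev_mul_rev_mul]

theorem stat2_31_rev_mul : stat2_31 (Fin.revPerm * σ) = stat2_13 σ := by
  rw [← stat2_13_rev_mul, rev_mul_rev_mul]

end symmetries

section poly

variable {R : Type*} [CommSemiring R] (n : ℕ) (p q r s : R)

theorem bdsPoly_reverse : bdsPoly n p q r s = bdsPoly n s r q p := by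
  rw [bdsPoly, ← Equiv.sum_comp (Equiv.mulRight Fin.revPerm)]
  refine Finset.sum_congr rfl fun σ _ => ?_
  rw [Equiv.coe_mulRight, stat13_2_mul_rev, stat31_2_mul_rev, stat2_13_mul_rev, stat2_31_mul_rev]
  ring

theorem bdsPoly_complement : bdsPoly n p q r s = bdsPoly n q p s r := by
  rw [bdsPoly, ← Equiv.sum_comp (Equiv.mulLeft Fin.revPerm)]
  refine Finset.sum_congr rfl fun σ _ => ?_
  rw [Equiv.coe_mulLeft, stat13_2_rev_mul, stat31_2_rev_mul, stat2_13_rev_mul, stat2_31_rev_mul]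
  ring

/-- The relation that `phiHat` proves; the other three follow by reversal and complement. -/
theorem bdsPoly_one_left : bdsPoly n 1 q r s = bdsPoly n 1 q s r := by
  rw [bdsPoly, ← Equiv.sum_comp (phiHat_involutive n).toPerm]
  refine Finset.sum_congr rfl fun σ _ => ?_
  have h1 := stat_phiHat σ
  have h2 := stat_phiHat (phiHat σ)
  rw [phiHat_involutive n σ] at h2
  rw [Function.Involutive.coe_toPerm, ← h1.1, ← h1.2, h2.2]
  ring

end poly

theorem theorem1p3 (n : ℕ) :
    -- the Shin-Zeng construction always runs to its end and defines a bijection of `S_n`,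
    -- so that `φ̂` is well defined
    (∀ σ : Equiv.Perm (Fin n), ∃! τ : Equiv.Perm (Fin n), IsSZImage σ τ) ∧
    Function.Bijective (phiSZ (n := n)) ∧
    -- `φ̂` is an involution with the stated effect on the statistics
    Function.Involutive (phiHat (n := n)) ∧
    (∀ σ : Equiv.Perm (Fin n),
      (stat31_2 σ, stat2_31 σ) = (stat31_2 (phiHat σ), stat2_13 (phiHat σ))) ∧
    (∀ σ : Equiv.Perm (Fin n),
      (stat31_2 σ, stat2_13 σ, stat2_31 σ) =
        (stat31_2 (phiHat σ), stat2_31 (phiHat σ), stat2_13 (phiHat σ))) ∧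
    -- the four relations of the conjecture, the first being the one named in the result
    (∀ (R : Type*) [CommSemiring R] (p q r s : R),
      bdsPoly n 1 q r s = bdsPoly n 1 q s r ∧
      bdsPoly n p 1 r s = bdsPoly n p 1 s r ∧
      bdsPoly n p q 1 s = bdsPoly n q p 1 s ∧
      bdsPoly n p q r 1 = bdsPoly n q p r 1) := by
  have hphi : ∀ σ : Equiv.Perm (Fin n), stat2_13 σ = stat2_31 (phiHat σ) := fun σ => by
    rw [(stat_phiHat (phiHat σ)).2, phiHat_involutive n σ]
  refine ⟨existsUnique_isSZImage, phiSZ_bijective n, phiHat_involutive n, fun σ => ?_, fun σ => ?_,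
    fun R _ p q r s => ⟨bdsPoly_one_left n q r s, ?_, ?_, ?_⟩⟩
  · rw [(stat_phiHat σ).1, (stat_phiHat σ).2]
  · rw [← (stat_phiHat σ).1, ← (stat_phiHat σ).2, ← hphi]
  · rw [bdsPoly_complement, bdsPoly_one_left, bdsPoly_complement]
  · rw [bdsPoly_reverse, bdsPoly_complement, bdsPoly_one_left, bdsPoly_complement, bdsPoly_reverse]
  · rw [bdsPoly_reverse, bdsPoly_one_left, bdsPoly_reverse]
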